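/- Let $H$ be a complex Hilbert space with an orthonormal basis $(e_i)_{i\ge 0}$ (for instance the Hardy space $H^2(\mathbb{D})$ with $e_i=z^i$), let $a\ge 1$, and let $S_w$ be the bounded operator on $H$ with $S_we_i=a^{-i}e_{i+1}$ for all $i\ge 0$. Let $H\otimes H$ be the Hilbert space tensor product, let $H\odot H$ and $H\wedge H$ be its closed subspaces of symmetric and antisymmetric tensors (those $v$ with $Fv=v$ and with $Fv=-v$, where $F(x\otimes y)=y\otimes x$), and let $S_w\odot S_w^*$ and $S_w\wedge S_w^*$ be the restrictions of $\frac12(S_w\otimes S_w^*+S_w^*\otimes S_w)$ to $H\odot H$ and to $H\wedge H$. Then the eigenvalues of these operators are $$\sigma_p(S_w\odot S_w^*)=\left\{\left\{\frac{1}{a^{k-1}}\cos\left(\frac{(2j-1)\pi}{k+2}\right):\ k\ge 0,\ 1\le j\le\left\lfloor\frac{k+2}{2}\right\rfloor\right\}\right\},$$ $$\sigma_p(S_w\wedge S_w^*)=\left\{\left\{\frac{1}{a^{k-1}}\cos\left(\frac{2j\pi}{k+2}\right):\ k\ge 1,\ 1\le j\le\left\lfloor\frac{k+1}{2}\right\rfloor\right\}\right\},$$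 as multisets in which every eigenvalue is repeated by multiplicity; that is, for every $\mu\in\mathbb{C}$, the dimension of the eigenspace for $\mu$ (an element of $\{0,1,2,\dots,\infty\}$) is the number of pairs $(k,j)$ in the given range at which the expression equals $\mu$. In particular, $\dim\ker(S_w\odot S_w^*)=\infty$ and $\dim\ker(S_w\wedge S_w^*)=\infty$. If $a>1$, then $S_w\odot S_w^*$ and $S_w\wedge S_w^*$ are compact and self-adjoint, and $\sigma(S_w\odot S_w^*)=\sigma_p(S_w\odot S_w^*)$ and $\sigma(S_w\wedge S_w^*)=\sigma_p(S_w\wedge S_w^*)$ as sets. -/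

import Mathlib

open scoped TensorProduct

noncomputable section

/-! ### Unilateral weighted shifts -/

section WeightedShift

variable {H : Type*} [NormedAddCommGroup H] [InnerProductSpace ℂ H]

/-- Multiplication of an `ℓ²` sequence by a bounded sequence of weights. -/
def ellTwoDiagonal (w : ℕ → ℂ) (hw : BddAbove (Set.range fun i => ‖w i‖)) :
    lp (fun _ : ℕ => ℂ) 2 →L[ℂ] lp (fun _ : ℕ => ℂ) 2 :=
  lp.mapCLM 2 (fun i => w i • ContinuousLinearMap.id ℂ ℂ) (K := ⨆ j, ‖w j‖)
    (Real.iSup_nonneg fun _ => norm_nonneg _)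
    (fun i => by simpa [norm_smul] using le_ciSup hw i)

/-- The isometry of `ℓ²` into `H` that sends the `i`-th standard unit vector to `e (i + 1)`. -/
def shiftIsometry [CompleteSpace H] (e : HilbertBasis ℕ ℂ H) :
    lp (fun _ : ℕ => ℂ) 2 →ₗᵢ[ℂ] H :=
  (e.orthonormal.comp Nat.succ Nat.succ_injective).orthogonalFamily.linearIsometry

/-- The unilateral weighted shift `S_w` with bounded weights `w` on a Hilbert space with
orthonormal basis `e`: the bounded operator with `S_w (e i) = w i • e (i + 1)`. -/
def weightedShift [CompleteSpace H] (e : HilbertBasis ℕ ℂ H) (w : ℕ → ℂ)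
    (hw : BddAbove (Set.range fun i => ‖w i‖)) : H →L[ℂ] H :=
  (shiftIsometry e).toContinuousLinearMap ∘L ellTwoDiagonal w hw ∘L
    (e.repr.toContinuousLinearEquiv : H →L[ℂ] lp (fun _ : ℕ => ℂ) 2)

theorem weightedShift_apply_basis [CompleteSpace H] (e : HilbertBasis ℕ ℂ H) (w : ℕ → ℂ)
    (hw : BddAbove (Set.range fun i => ‖w i‖)) (i : ℕ) :
    weightedShift e w hw (e i) = w i • e (i + 1) := by
  have h : ellTwoDiagonal w hw (lp.single 2 i (1 : ℂ)) = lp.single 2 i (w i) := by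
    ext j
    change w j * (lp.single 2 i (1 : ℂ) : lp (fun _ : ℕ => ℂ) 2) j = _
    by_cases hj : j = i
    · subst hj; simp
    · simp [lp.single_apply, hj]
  simp only [weightedShift, ContinuousLinearMap.comp_apply]
  change shiftIsometry e (ellTwoDiagonal w hw (e.repr (e i))) = _
  rw [e.repr_self, h, shiftIsometry, OrthogonalFamily.linearIsometry_apply_single]
  simp

end WeightedShift

/-- The weights `1 / a ^ i` are bounded when `a ≥ 1`. -/
theorem bddAbove_geometricWeight {a : ℝ} (ha : 1 ≤ a) :
    BddAbove (Set.range fun i : ℕ => ‖((1 / a ^ i : ℝ) : ℂ)‖) := by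
  refine ⟨1, ?_⟩
  rintro _ ⟨i, rfl⟩
  have h : (1 : ℝ) ≤ a ^ i := one_le_pow₀ ha
  have h0 : (0 : ℝ) < a ^ i := by linarith
  simp only [Complex.norm_real, Real.norm_eq_abs]
  rw [abs_of_pos (by positivity), div_le_one h0]
  exact h

/-- The weighted shift with weights `w i = 1 / a ^ i`, where `a ≥ 1`. -/
def geometricShift {H : Type*} [NormedAddCommGroup H] [InnerProductSpace ℂ H] [CompleteSpace H]
    (e : HilbertBasis ℕ ℂ H) (a : ℝ) (ha : 1 ≤ a) : H →L[ℂ] H :=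
  weightedShift e (fun i => ((1 / a ^ i : ℝ) : ℂ)) (bddAbove_geometricWeight ha)

/-! ### Symmetric and antisymmetric tensor products -/

section HilbertTensor

variable (H : Type*) [NormedAddCommGroup H] [InnerProductSpace ℂ H]

/-- The Hilbert space tensor square: the completion of the algebraic tensor square for the inner
product with `⟪u ⊗ v, u' ⊗ v'⟫ = ⟪u, u'⟫ * ⟪v, v'⟫`. -/
def HilbertTensorSq : Type _ := UniformSpace.Completion (H ⊗[ℂ] H)

namespace HilbertTensorSq

instance : NormedAddCommGroup (HilbertTensorSq H) :=
  inferInstanceAs (NormedAddCommGroup (UniformSpace.Completion (H ⊗[ℂ] H)))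

instance : InnerProductSpace ℂ (HilbertTensorSq H) :=
  inferInstanceAs (InnerProductSpace ℂ (UniformSpace.Completion (H ⊗[ℂ] H)))

instance : CompleteSpace (HilbertTensorSq H) :=
  inferInstanceAs (CompleteSpace (UniformSpace.Completion (H ⊗[ℂ] H)))

/-- The embedding of the algebraic tensor square. -/
def incl : H ⊗[ℂ] H →ₗᵢ[ℂ] HilbertTensorSq H :=
  (UniformSpace.Completion.toComplₗᵢ : H ⊗[ℂ] H →ₗᵢ[ℂ] UniformSpace.Completion (H ⊗[ℂ] H))

theorem denseRange_incl : DenseRange (incl H) :=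
  UniformSpace.Completion.denseRange_coe

variable {H}

/-- The continuous extension of a bounded operator on the algebraic tensor square. -/
def extendOp (T : H ⊗[ℂ] H →L[ℂ] H ⊗[ℂ] H) : HilbertTensorSq H →L[ℂ] HilbertTensorSq H :=
  (T.completion : UniformSpace.Completion (H ⊗[ℂ] H) →L[ℂ] UniformSpace.Completion (H ⊗[ℂ] H))

theorem extendOp_incl (T : H ⊗[ℂ] H →L[ℂ] H ⊗[ℂ] H) (x : H ⊗[ℂ] H) :
    extendOp T (incl H x) = incl H (T x) :=
  ContinuousLinearMap.completion_apply_coe T x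

end HilbertTensorSq

/-- The flip operator: the continuous extension of `u ⊗ v ↦ v ⊗ u`. -/
def tensorFlip : HilbertTensorSq H →L[ℂ] HilbertTensorSq H :=
  HilbertTensorSq.extendOp ((TensorProduct.commIsometry ℂ H H).toContinuousLinearEquiv :
    H ⊗[ℂ] H →L[ℂ] H ⊗[ℂ] H)

/-- `H ⊙ H`: the tensors that are fixed by the flip. -/
def symTensor : Submodule ℂ (HilbertTensorSq H) where
  carrier := {v | tensorFlip H v = v}
  add_mem' hu hv := by simp_all
  zero_mem' := by simp
  smul_mem' c v hv := by simp_all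

/-- `H ∧ H`: the tensors that are negated by the flip. -/
def antisymTensor : Submodule ℂ (HilbertTensorSq H) where
  carrier := {v | tensorFlip H v = -v}
  add_mem' hu hv := by simp_all [add_comm]
  zero_mem' := by simp
  smul_mem' c v hv := by simp_all

instance completeSpace_symTensor : CompleteSpace (symTensor H) :=
  (isClosed_eq (tensorFlip H).continuous continuous_id :
    IsClosed {v | tensorFlip H v = v}).completeSpace_coe

instance completeSpace_antisymTensor : CompleteSpace (antisymTensor H) :=
  (isClosed_eq (tensorFlip H).continuous continuous_neg :
    IsClosed {v | tensorFlip H v = -v}).completeSpace_coe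

variable {H}

/-- `A ⊗ B` on the Hilbert space tensor square: the continuous extension of
`u ⊗ v ↦ A u ⊗ B v`. -/
def tensorOp (A B : H →L[ℂ] H) : HilbertTensorSq H →L[ℂ] HilbertTensorSq H :=
  HilbertTensorSq.extendOp (TensorProduct.mapL A B)

/-- The symmetrized operator `(A ⊗ B + B ⊗ A) / 2`. -/
def symmetrizedOp (A B : H →L[ℂ] H) : HilbertTensorSq H →L[ℂ] HilbertTensorSq H :=
  (1 / 2 : ℂ) • (tensorOp A B + tensorOp B A)

theorem tensorFlip_tensorOp (A B : H →L[ℂ] H) (v : HilbertTensorSq H) :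
    tensorFlip H (tensorOp A B v) = tensorOp B A (tensorFlip H v) := by
  refine (HilbertTensorSq.denseRange_incl H).induction_on
    (p := fun v => tensorFlip H (tensorOp A B v) = tensorOp B A (tensorFlip H v)) v
    (isClosed_eq (by fun_prop) (by fun_prop)) (fun x => ?_)
  simp only [tensorFlip, tensorOp, HilbertTensorSq.extendOp_incl]
  congr 1
  induction x using TensorProduct.induction_on with
  | zero => simp
  | tmul u v => simp
  | add x y hx hy => simp only [map_add, hx, hy]

theorem tensorFlip_symmetrizedOp (A B : H →L[ℂ] H) (v : HilbertTensorSq H) :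
    tensorFlip H (symmetrizedOp A B v) = symmetrizedOp A B (tensorFlip H v) := by
  simp [symmetrizedOp, tensorFlip_tensorOp, add_comm]

/-- `A ⊙ B`: the restriction of `(A ⊗ B + B ⊗ A) / 2` to `H ⊙ H`. -/
def symTensorOp (A B : H →L[ℂ] H) : symTensor H →L[ℂ] symTensor H :=
  (symmetrizedOp A B).restrict (p := symTensor H) (q := symTensor H) (fun v hv => by
    change tensorFlip H v = v at hv
    change tensorFlip H (symmetrizedOp A B v) = symmetrizedOp A B v
    rw [tensorFlip_symmetrizedOp, hv])

/-- `A ∧ B`: the restriction of `(A ⊗ B + B ⊗ A) / 2` to `H ∧ H`. -/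
def antisymTensorOp (A B : H →L[ℂ] H) : antisymTensor H →L[ℂ] antisymTensor H :=
  (symmetrizedOp A B).restrict (p := antisymTensor H) (q := antisymTensor H) (fun v hv => by
    change tensorFlip H v = -v at hv
    change tensorFlip H (symmetrizedOp A B v) = -symmetrizedOp A B v
    rw [tensorFlip_symmetrizedOp, hv, map_neg])

end HilbertTensor

/-! ### Eigenvalues -/

section Eigenvalues

variable {K : Type*} [NormedAddCommGroup K] [InnerProductSpace ℂ K]

/-- The point spectrum, that is, the set of eigenvalues. -/
def pointSpectrum (T : K →L[ℂ] K) : Set ℂ :=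
  {μ | Module.End.HasEigenvalue (T : K →ₗ[ℂ] K) μ}

/-- The multiplicity of `μ` as an eigenvalue of `T`: the dimension of `ker (T - μ)`, which is `⊤`
if that space is infinite-dimensional and `0` if `μ` is not an eigenvalue. -/
def eigenvalueMultiplicity (T : K →L[ℂ] K) (μ : ℂ) : ℕ∞ :=
  Cardinal.toENat (Module.rank ℂ (Module.End.eigenspace (T : K →ₗ[ℂ] K) μ))

end Eigenvalues

/-! ### The listed families of eigenvalues -/

/-- The indices `(k, j)` with `k ≥ 0` and `1 ≤ j ≤ ⌊(k + 2) / 2⌋`. -/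
def symIndex : Set (ℕ × ℕ) := {q | 1 ≤ q.2 ∧ q.2 ≤ (q.1 + 2) / 2}

/-- The indices `(k, j)` with `k ≥ 1` and `1 ≤ j ≤ ⌊(k + 1) / 2⌋`. -/
def antisymIndex : Set (ℕ × ℕ) := {q | 1 ≤ q.1 ∧ 1 ≤ q.2 ∧ q.2 ≤ (q.1 + 1) / 2}

/-- The number `a ^ (-(k - 1)) * cos ((2 * j - 1) * π / (k + 2))` at `q = (k, j)`; the exponent is
an integer, which is `1` at `k = 0`. -/
def symValue (a : ℝ) (q : ℕ × ℕ) : ℂ :=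
  ((1 / a ^ ((q.1 : ℤ) - 1) *
    Real.cos ((2 * (q.2 : ℝ) - 1) * Real.pi / ((q.1 : ℝ) + 2)) : ℝ) : ℂ)

/-- The number `a ^ (-(k - 1)) * cos (2 * j * π / (k + 2))` at `q = (k, j)`. -/
def antisymValue (a : ℝ) (q : ℕ × ℕ) : ℂ :=
  ((1 / a ^ ((q.1 : ℤ) - 1) *
    Real.cos (2 * (q.2 : ℝ) * Real.pi / ((q.1 : ℝ) + 2)) : ℝ) : ℂ)

/-- The operator `S_w ⊙ S_w*` for the weights `w i = 1 / a ^ i`. -/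
def symShift {H : Type*} [NormedAddCommGroup H] [InnerProductSpace ℂ H] [CompleteSpace H]
    (e : HilbertBasis ℕ ℂ H) (a : ℝ) (ha : 1 ≤ a) : symTensor H →L[ℂ] symTensor H :=
  symTensorOp (geometricShift e a ha) (ContinuousLinearMap.adjoint (geometricShift e a ha))

/-- The operator `S_w ∧ S_w*` for the weights `w i = 1 / a ^ i`. -/
def antisymShift {H : Type*} [NormedAddCommGroup H] [InnerProductSpace ℂ H] [CompleteSpace H]
    (e : HilbertBasis ℕ ℂ H) (a : ℝ) (ha : 1 ≤ a) : antisymTensor H →L[ℂ] antisymTensor H :=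
  antisymTensorOp (geometricShift e a ha) (ContinuousLinearMap.adjoint (geometricShift e a ha))

end

/-! The operator `(S_w ⊗ S_w* + S_w* ⊗ S_w) / 2` preserves, for every `k`, the span of the tensors
`e i ⊗ e (k - i)`, `0 ≤ i ≤ k`. Moving one step along these tensors always costs the factor
`a ^ (-i) * a ^ (-(k - i - 1)) = a ^ (-(k - 1))`, whatever `i` is, so on this span the operator is
`a ^ (-(k - 1)) / 2` times the adjacency matrix of a path with `k + 1` vertices. Its eigenvectors
are the standing waves `modeVector e k m`, `1 ≤ m ≤ k + 1`, with eigenvalues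
`modeValue a k m = a ^ (-(k - 1)) * cos (m * π / (k + 2))` (`symmetrizedOp_modeVector`). They are
pairwise orthogonal, because for fixed `k` they belong to distinct eigenvalues of a symmetric
operator (`inner_modeVector_eq_zero`), and by a dimension count they are total
(`eq_zero_of_inner_modeVector_eq_zero`).

The flip reflects the path and therefore multiplies `modeVector e k m` by `(-1) ^ (m + 1)`
(`tensorFlip_modeVector`). Hence the vectors with `m = 2 * j - 1` give a Hilbert basis of the
symmetric tensors and those with `m = 2 * j` one of the antisymmetric tensors, and in these bases
the two restrictions are diagonal (`exists_hilbertBasis_modeVector`). For a symmetric operator that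
is diagonal in a Hilbert basis, the multiplicity of `μ` is the number of diagonal entries equal to
`μ`, and the operator is compact when the entries tend to zero. The value `0`, the cosine of
`π / 2`, occurs for infinitely many `k`, so it is an eigenvalue of infinite multiplicity, and the
spectrum of the compact operator consists of eigenvalues only by the Fredholm alternative.
-/

open scoped TensorProduct

noncomputable section

/-! ### Operators that are diagonal in a Hilbert basis -/

section Diagonal

variable {K : Type*} [NormedAddCommGroup K] [InnerProductSpace ℂ K] {ι : Type*}

/-- A total orthogonal family of nonzero vectors becomes a Hilbert basis after normalization. -/
theorem exists_hilbertBasis_of_orthogonal [CompleteSpace K] (v : ι → K) (hne : ∀ i, v i ≠ 0)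
    (horth : Pairwise fun i j => inner ℂ (v i) (v j) = 0)
    (htotal : ∀ x, (∀ i, inner ℂ (v i) x = 0) → x = 0) :
    ∃ b : HilbertBasis ι ℂ K, ∀ i, b i = ((‖v i‖⁻¹ : ℝ) : ℂ) • v i := by
  have hn : Orthonormal ℂ fun i => ((‖v i‖⁻¹ : ℝ) : ℂ) • v i := by
    refine ⟨fun i => ?_, fun i j hij => ?_⟩
    · rw [norm_smul, Complex.norm_real, norm_inv, norm_norm, inv_mul_cancel₀]
      exact norm_ne_zero_iff.2 (hne i)
    · simp [inner_smul_left, inner_smul_right, horth hij]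
  refine ⟨HilbertBasis.mkOfOrthogonalEqBot hn ?_, fun i => by simp⟩
  refine (Submodule.eq_bot_iff _).2 fun x hx => htotal x fun i => ?_
  have h := (Submodule.mem_orthogonal _ x).1 hx _ (Submodule.subset_span ⟨i, rfl⟩)
  rw [inner_smul_left] at h
  refine (mul_eq_zero.1 h).resolve_left ?_
  simpa using hne i

theorem HilbertBasis.ext_repr (b : HilbertBasis ι ℂ K) {x y : K}
    (h : ∀ i, b.repr x i = b.repr y i) : x = y :=
  b.repr.injective (lp.ext (funext h))

/-- The norm comparison behind the estimate of the truncation error of a diagonal operator. -/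
theorem HilbertBasis.norm_le_of_repr_le (b : HilbertBasis ι ℂ K) {x y : K} {C : ℝ} (hC : 0 ≤ C)
    (h : ∀ i, ‖b.repr y i‖ ≤ C * ‖b.repr x i‖) : ‖y‖ ≤ C * ‖x‖ := by
  have h1 : ‖b.repr y‖ ≤ ‖(C : ℂ) • b.repr x‖ := by
    refine lp.norm_mono (by norm_num) fun i => ?_
    rw [lp.coeFn_smul, Pi.smul_apply, norm_smul, Complex.norm_real, Real.norm_of_nonneg hC]
    exact h i
  rwa [norm_smul, Complex.norm_real, Real.norm_of_nonneg hC, b.repr.norm_map,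
    b.repr.norm_map] at h1

section Symmetric

variable {T : K →L[ℂ] K} (hT : (T : K →ₗ[ℂ] K).IsSymmetric) (b : HilbertBasis ι ℂ K)
  {lam : ι → ℝ} (hb : ∀ i, T (b i) = (lam i : ℂ) • b i)

include hT hb

theorem repr_apply_of_diagonal (x : K) (i : ι) : b.repr (T x) i = lam i * b.repr x i := by
  have h := hT (b i) x
  simp only [ContinuousLinearMap.coe_coe] at h
  rw [b.repr_apply_apply, b.repr_apply_apply, ← h, hb, inner_smul_left, Complex.conj_ofReal]

theorem mem_eigenspace_iff_repr_eq_zero (μ : ℂ) (x : K) :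
    x ∈ Module.End.eigenspace (T : K →ₗ[ℂ] K) μ ↔ ∀ i, (lam i : ℂ) ≠ μ → b.repr x i = 0 := by
  rw [Module.End.mem_eigenspace_iff]
  constructor
  · intro h i hi
    have h1 : b.repr (T x) i = b.repr (μ • x) i := congrArg (fun y => b.repr y i) h
    rw [repr_apply_of_diagonal hT b hb, map_smul, lp.coeFn_smul, Pi.smul_apply, smul_eq_mul,
      ← sub_eq_zero, ← sub_mul] at h1
    exact (mul_eq_zero.1 h1).resolve_left (sub_ne_zero.2 hi)
  · intro h
    refine b.ext_repr fun i => ?_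
    rw [ContinuousLinearMap.coe_coe, repr_apply_of_diagonal hT b hb, map_smul, lp.coeFn_smul,
      Pi.smul_apply, smul_eq_mul]
    by_cases hi : (lam i : ℂ) = μ
    · rw [hi]
    · rw [h i hi, mul_zero, mul_zero]

theorem eigenvalueMultiplicity_of_diagonal (μ : ℂ) :
    eigenvalueMultiplicity T μ = {i | (lam i : ℂ) = μ}.encard := by
  set Z : Set ι := {i | (lam i : ℂ) = μ} with hZ
  have hmem : ∀ i : Z, b i ∈ Module.End.eigenspace (T : K →ₗ[ℂ] K) μ := fun i => by
    rw [Module.End.mem_eigenspace_iff, ← show (lam i : ℂ) = μ from i.2]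
    exact hb i
  have hli : LinearIndependent ℂ fun i : Z => b i :=
    b.orthonormal.linearIndependent.comp _ Subtype.val_injective
  have hli' : LinearIndependent ℂ
      (fun i : Z => (⟨b i, hmem i⟩ : Module.End.eigenspace (T : K →ₗ[ℂ] K) μ)) :=
    LinearIndependent.of_comp (Submodule.subtype _) hli
  rw [eigenvalueMultiplicity]
  -- A finite `Z` indexes a basis of the eigenspace; an infinite one is an infinite independent
  -- family in it, which is all that the value `⊤` needs.
  by_cases hfin : Z.Finite
  · have := hfin.fintype
    have hspan : Submodule.span ℂ (Set.range fun i : Z => b i) =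
        Module.End.eigenspace (T : K →ₗ[ℂ] K) μ := by
      refine le_antisymm (Submodule.span_le.2 (by rintro _ ⟨i, rfl⟩; exact hmem i)) fun x hx => ?_
      have hx' := (mem_eigenspace_iff_repr_eq_zero hT b hb μ x).1 hx
      have hs := hasSum_sum_of_ne_finset_zero (f := fun i => b.repr x i • b i)
        (s := hfin.toFinset) (L := SummationFilter.unconditional _) fun i hi => by
          rw [hx' i (by simpa [hZ] using hi), zero_smul]
      rw [(b.hasSum_repr x).unique hs]
      exact Submodule.sum_mem _ fun i hi => Submodule.smul_mem _ _
        (Submodule.subset_span ⟨⟨i, by simpa using hi⟩, rfl⟩)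
    rw [← hspan, rank_span hli, Set.toENat_cardinalMk, ← Set.image_eq_range,
      b.orthonormal.linearIndependent.injective.encard_image]
  · have hinf : Infinite Z := Set.infinite_coe_iff.2 hfin
    rw [Set.encard_eq_top_iff.2 hfin, Cardinal.toENat_eq_top]
    by_contra hlt
    have hfd : Module.Finite ℂ (Module.End.eigenspace (T : K →ₗ[ℂ] K) μ) :=
      Module.rank_lt_aleph0_iff.1 (not_le.1 hlt)
    exact not_finite_iff_infinite.2 hinf hli'.finite

theorem pointSpectrum_of_diagonal : pointSpectrum T = Set.range fun i => (lam i : ℂ) := by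
  ext μ
  constructor
  · intro h
    obtain ⟨x, hx, hx0⟩ := Module.End.HasEigenvalue.exists_hasEigenvector h
    by_contra hμ
    refine hx0 (b.ext_repr fun i => ?_)
    rw [(mem_eigenspace_iff_repr_eq_zero hT b hb μ x).1 hx i fun hi => hμ ⟨i, hi⟩]
    simp
  · rintro ⟨i, rfl⟩
    exact Module.End.hasEigenvalue_of_hasEigenvector (x := b i)
      ⟨Module.End.mem_eigenspace_iff.2 (hb i), b.orthonormal.ne_zero i⟩

theorem not_finiteDimensional_ker_of_diagonal (h0 : {i | lam i = 0}.Infinite) :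
    ¬ FiniteDimensional ℂ T.ker := by
  intro hfd
  have h := eigenvalueMultiplicity_of_diagonal hT b hb 0
  rw [eigenvalueMultiplicity, Set.encard_eq_top_iff.2 (by simpa using h0), Cardinal.toENat_eq_top,
    Module.End.eigenspace_zero] at h
  exact absurd (Module.rank_lt_aleph0_iff.2 hfd) (not_lt.2 h)

/-- The finite truncations of the diagonal operator have finite rank and, since the eigenvalues
tend to zero, converge to it in norm. -/
theorem isCompactOperator_of_diagonal [CompleteSpace K]
    (h0 : Filter.Tendsto lam Filter.cofinite (nhds 0)) :
    IsCompactOperator T := by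
  classical
  let R : Finset ι → K →L[ℂ] K := fun F => ∑ i ∈ F,
    (ContinuousLinearMap.toSpanSingleton ℂ ((lam i : ℂ) • b i)) ∘L innerSL ℂ (b i)
  have hR : ∀ F, IsCompactOperator (R F) := fun F => by
    refine Submodule.sum_mem (compactOperator (RingHom.id ℂ) K K) fun i _ => ?_
    exact (isCompactOperator_of_locallyCompactSpace_dom (innerSL ℂ (b i))).clm_comp
      (ContinuousLinearMap.toSpanSingleton ℂ ((lam i : ℂ) • b i))
  have hrepr : ∀ F x i, b.repr (R F x) i = if i ∈ F then lam i * b.repr x i else 0 := by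
    intro F x i
    rw [b.repr_apply_apply, b.repr_apply_apply]
    simp only [R, sum_apply, ContinuousLinearMap.comp_apply,
      ContinuousLinearMap.toSpanSingleton_apply, innerSL_apply_apply, inner_sum, inner_smul_right,
      orthonormal_iff_ite.1 b.orthonormal]
    simp [mul_comm]
  refine isCompactOperator_of_tendsto (l := Filter.atTop) (F := R) ?_
    (Filter.Eventually.of_forall hR)
  rw [Metric.tendsto_atTop]
  intro ε hε
  have hfin : {i | ¬ |lam i| < ε / 2}.Finite := by
    have := Metric.tendsto_nhds.1 h0 (ε / 2) (half_pos hε)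
    simpa [Filter.eventually_cofinite] using this
  refine ⟨hfin.toFinset, fun F hF => ?_⟩
  rw [dist_eq_norm]
  refine lt_of_le_of_lt (ContinuousLinearMap.opNorm_le_bound _ (half_pos hε).le fun x => ?_)
    (half_lt_self hε)
  refine b.norm_le_of_repr_le (half_pos hε).le fun i => ?_
  rw [sub_apply, map_sub, lp.coeFn_sub, Pi.sub_apply, hrepr,
    repr_apply_of_diagonal hT b hb]
  by_cases hi : i ∈ F
  · simp only [hi, if_true, sub_self, norm_zero]; positivity
  · have hi' : |lam i| < ε / 2 := by
      by_contra h
      exact hi (hF (by simpa using h))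
    simp only [hi, if_false, zero_sub, norm_neg, norm_mul, Complex.norm_real, Real.norm_eq_abs]
    gcongr

end Symmetric

/-- A nonzero spectral value of a compact operator is an eigenvalue by the Fredholm alternative. -/
theorem spectrum_eq_pointSpectrum_of_isCompactOperator [CompleteSpace K] {T : K →L[ℂ] K}
    (hT : IsCompactOperator T) (h0 : 0 ∈ pointSpectrum T) : spectrum ℂ T = pointSpectrum T := by
  ext μ
  by_cases hμ : μ = 0
  · subst hμ
    refine iff_of_true ?_ h0
    rw [ContinuousLinearMap.spectrum_eq]
    exact Module.End.HasEigenvalue.mem_spectrum h0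
  · exact (hT.hasEigenvalue_iff_mem_spectrum hμ).symm

end Diagonal

/-! ### The Hilbert space tensor square -/

section TensorSquare

variable {H : Type*} [NormedAddCommGroup H] [InnerProductSpace ℂ H]

open HilbertTensorSq

theorem HilbertTensorSq.inner_extendOp (A B : H ⊗[ℂ] H →L[ℂ] H ⊗[ℂ] H)
    (h : ∀ x y, inner ℂ (A x) y = inner ℂ x (B y)) (x y : HilbertTensorSq H) :
    inner ℂ (extendOp A x) y = inner ℂ x (extendOp B y) := by
  refine (denseRange_incl H).induction_on₂
    (p := fun x y => inner ℂ (extendOp A x) y = inner ℂ x (extendOp B y))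
    (isClosed_eq (by fun_prop) (by fun_prop)) (fun x y => ?_) x y
  simp only [extendOp_incl, LinearIsometry.inner_map_map, h]

theorem inner_tensorFlip (x y : HilbertTensorSq H) :
    inner ℂ (tensorFlip H x) y = inner ℂ x (tensorFlip H y) := by
  refine HilbertTensorSq.inner_extendOp _ _ (fun x y => ?_) x y
  change inner ℂ (TensorProduct.comm ℂ H H x) y = inner ℂ x (TensorProduct.comm ℂ H H y)
  rw [← TensorProduct.inner_comm_comm (TensorProduct.comm ℂ H H x)]
  congr 1
  exact (TensorProduct.comm ℂ H H).symm_apply_apply x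

/-- Eigenvectors of the flip for the eigenvalues `1` and `-1` are orthogonal. -/
theorem inner_eq_zero_of_tensorFlip {x y : HilbertTensorSq H} (hx : tensorFlip H x = x)
    (hy : tensorFlip H y = -y) : inner ℂ x y = 0 := by
  have h := inner_tensorFlip x y
  rw [hx, hy, inner_neg_right] at h
  exact self_eq_neg.1 h

theorem inner_tensorOp [CompleteSpace H] (A B : H →L[ℂ] H) (x y : HilbertTensorSq H) :
    inner ℂ (tensorOp A B x) y = inner ℂ x (tensorOp A.adjoint B.adjoint y) := by
  refine HilbertTensorSq.inner_extendOp _ _ (fun x y => ?_) x y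
  induction x using TensorProduct.induction_on with
  | zero => simp
  | add x x' hx hx' => rw [map_add, inner_add_left, inner_add_left, hx, hx']
  | tmul u v =>
    induction y using TensorProduct.induction_on with
    | zero => simp
    | add y y' hy hy' => rw [map_add, inner_add_right, inner_add_right, hy, hy']
    | tmul u' v' =>
      rw [TensorProduct.mapL_tmul, TensorProduct.mapL_tmul, TensorProduct.inner_tmul,
        TensorProduct.inner_tmul, ContinuousLinearMap.adjoint_inner_right,
        ContinuousLinearMap.adjoint_inner_right]

theorem isSymmetric_symmetrizedOp_adjoint [CompleteSpace H] (A : H →L[ℂ] H) :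
    (symmetrizedOp A A.adjoint : HilbertTensorSq H →ₗ[ℂ] HilbertTensorSq H).IsSymmetric := by
  intro x y
  simp only [ContinuousLinearMap.coe_coe, symmetrizedOp, smul_apply, add_apply, inner_smul_left,
    inner_smul_right, inner_add_left, inner_add_right, inner_tensorOp,
    ContinuousLinearMap.adjoint_adjoint]
  rw [add_comm]
  congr 1
  simp [map_ofNat (starRingEnd ℂ) 2]

/-- The tensor `e i ⊗ e j` of two basis vectors. -/
def basisTensor (e : HilbertBasis ℕ ℂ H) (i j : ℕ) : HilbertTensorSq H :=
  incl H (e i ⊗ₜ[ℂ] e j)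

variable (e : HilbertBasis ℕ ℂ H)

theorem inner_basisTensor (i j i' j' : ℕ) :
    inner ℂ (basisTensor e i j) (basisTensor e i' j') = if i = i' ∧ j = j' then 1 else 0 := by
  rw [basisTensor, basisTensor, LinearIsometry.inner_map_map, TensorProduct.inner_tmul,
    orthonormal_iff_ite.1 e.orthonormal, orthonormal_iff_ite.1 e.orthonormal]
  split_ifs <;> simp_all

theorem tensorFlip_basisTensor (i j : ℕ) :
    tensorFlip H (basisTensor e i j) = basisTensor e j i :=
  extendOp_incl _ _

theorem tensorOp_basisTensor (A B : H →L[ℂ] H) (i j : ℕ) :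
    tensorOp A B (basisTensor e i j) = incl H (A (e i) ⊗ₜ[ℂ] B (e j)) :=
  extendOp_incl _ _

theorem HilbertBasis.eq_of_eqOn_basis {ι K F : Type*} [NormedAddCommGroup K]
    [InnerProductSpace ℂ K] [NormedAddCommGroup F] [NormedSpace ℂ F] (b : HilbertBasis ι ℂ K)
    {f g : K →L[ℂ] F} (h : ∀ i, f (b i) = g (b i)) : f = g :=
  ContinuousLinearMap.ext_on
    (Submodule.dense_iff_topologicalClosure_eq_top.2 b.dense_span) (by rintro _ ⟨i, rfl⟩; exact h i)

theorem eq_zero_of_inner_basisTensor_eq_zero {x : HilbertTensorSq H}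
    (h : ∀ i j, inner ℂ (basisTensor e i j) x = 0) : x = 0 := by
  have hswap : ∀ i j, inner ℂ x (basisTensor e i j) = 0 := fun i j =>
    inner_eq_zero_symm.1 (h i j)
  -- The bounded bilinear form `(u, v) ↦ ⟪x, u ⊗ v⟫`, which vanishes on pairs of basis vectors.
  let f : H →L[ℂ] H →L[ℂ] ℂ :=
    (ContinuousLinearMap.compL ℂ H (H ⊗[ℂ] H) ℂ
      ((innerSL ℂ x) ∘L (incl H).toContinuousLinearMap)) ∘L TensorProduct.mkL ℂ H H
  have hf : f = 0 := e.eq_of_eqOn_basis fun i => e.eq_of_eqOn_basis fun j => hswap i j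
  have hx : innerSL ℂ x = 0 := by
    refine ContinuousLinearMap.coeFn_injective ((denseRange_incl H).equalizer
      (innerSL ℂ x).continuous (0 : HilbertTensorSq H →L[ℂ] ℂ).continuous (funext fun t => ?_))
    induction t using TensorProduct.induction_on with
    | zero => simp
    | add s t hs ht => 
      simp only [Function.comp_apply, map_add] at hs ht ⊢
      rw [hs, ht]
    | tmul u v => exact DFunLike.congr_fun (DFunLike.congr_fun hf u) v
  have h0 := DFunLike.congr_fun hx x
  simpa using h0

end TensorSquare

/-! ### The eigenvectors of the symmetrized operator -/

section Modes

/-- The number `a ^ (-(k - 1)) * cos (m * π / (k + 2))`; the exponent is an integer, which is `1`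
at `k = 0`. -/
def modeValue (a : ℝ) (k m : ℕ) : ℝ :=
  1 / a ^ ((k : ℤ) - 1) * Real.cos (m * Real.pi / (k + 2))

variable {H : Type*} [NormedAddCommGroup H] [InnerProductSpace ℂ H]

/-- The standing wave `∑ i ≤ k, sin ((i + 1) * m * π / (k + 2)) • e i ⊗ e (k - i)`, an eigenvector
of the adjacency matrix of the path `e 0 ⊗ e k, e 1 ⊗ e (k - 1), …, e k ⊗ e 0`. -/
def modeVector (e : HilbertBasis ℕ ℂ H) (k m : ℕ) : HilbertTensorSq H :=
  ∑ i ∈ Finset.range (k + 1),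
    (Real.sin ((i + 1 : ℕ) * (m * Real.pi / (k + 2))) : ℂ) • basisTensor e i (k - i)

variable (e : HilbertBasis ℕ ℂ H)

theorem inner_basisTensor_modeVector {k i : ℕ} (hi : i ≤ k) (m : ℕ) :
    inner ℂ (basisTensor e i (k - i)) (modeVector e k m) =
      Real.sin ((i + 1 : ℕ) * (m * Real.pi / (k + 2))) := by
  rw [modeVector, inner_sum, Finset.sum_eq_single i]
  · rw [inner_smul_right, inner_basisTensor]
    simp
  · intro j _ hj
    rw [inner_smul_right, inner_basisTensor, if_neg (fun h => hj h.1.symm), mul_zero]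
  · intro h
    exact absurd (Finset.mem_range.2 (Nat.lt_succ_of_le hi)) h

/-- The coefficient of `e 0 ⊗ e k` is `sin (m * π / (k + 2)) > 0`. -/
theorem modeVector_ne_zero {k m : ℕ} (h1 : 1 ≤ m) (h2 : m ≤ k + 1) : modeVector e k m ≠ 0 := by
  intro h
  have h' := inner_basisTensor_modeVector e (Nat.zero_le k) m
  rw [h, inner_zero_right] at h'
  have hm : (0 : ℝ) < m := by exact_mod_cast h1
  have hm2 : (m : ℝ) < k + 2 := by exact_mod_cast (by omega : m < k + 2)
  have hpos : 0 < Real.sin ((0 + 1 : ℕ) * (m * Real.pi / (k + 2))) := by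
    refine Real.sin_pos_of_pos_of_lt_pi (by positivity) ?_
    rw [zero_add, Nat.cast_one, one_mul, div_lt_iff₀ (by positivity), mul_comm]
    exact mul_lt_mul_of_pos_left hm2 Real.pi_pos
  exact hpos.ne (by exact_mod_cast h')

theorem inner_modeVector_of_ne {k k' : ℕ} (hk : k ≠ k') (m m' : ℕ) :
    inner ℂ (modeVector e k m) (modeVector e k' m') = 0 := by
  rw [modeVector, modeVector, sum_inner]
  refine Finset.sum_eq_zero fun i hi => ?_
  rw [inner_sum]
  refine Finset.sum_eq_zero fun j hj => ?_
  rw [inner_smul_left, inner_smul_right, inner_basisTensor, if_neg, mul_zero, mul_zero]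
  rw [Finset.mem_range] at hi hj
  omega

/-- The flip reverses the path, and `sin (m * π - t) = (-1) ^ (m + 1) * sin t`. -/
theorem tensorFlip_modeVector (k m : ℕ) :
    tensorFlip H (modeVector e k m) = (-1 : ℂ) ^ (m + 1) • modeVector e k m := by
  rw [modeVector, map_sum, ← Finset.sum_range_reflect, Finset.smul_sum]
  refine Finset.sum_congr rfl fun i hi => ?_
  have hi' : i ≤ k := Nat.lt_succ_iff.1 (Finset.mem_range.1 hi)
  have hsin : Real.sin ((k + 1 - 1 - i + 1 : ℕ) * (m * Real.pi / (k + 2))) =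
      (-1) ^ (m + 1) * Real.sin ((i + 1 : ℕ) * (m * Real.pi / (k + 2))) := by
    have harg : ((k + 1 - 1 - i + 1 : ℕ) : ℝ) * (m * Real.pi / (k + 2)) =
        m * Real.pi - (i + 1 : ℕ) * (m * Real.pi / (k + 2)) := by
      have : ((k + 1 - 1 - i + 1 : ℕ) : ℝ) = k + 2 - (i + 1 : ℕ) := by
        rw [eq_sub_iff_add_eq]
        exact_mod_cast (by omega : k + 1 - 1 - i + 1 + (i + 1) = k + 2)
      rw [this]
      field_simp
    rw [harg, Real.sin_nat_mul_pi_sub, pow_succ]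
    ring
  rw [map_smul, tensorFlip_basisTensor, hsin, smul_smul, show k + 1 - 1 - i = k - i by omega,
    Nat.sub_sub_self hi']
  push_cast
  rfl

theorem tensorFlip_modeVector_of_odd (k : ℕ) {m : ℕ} (hm : Odd m) :
    tensorFlip H (modeVector e k m) = modeVector e k m := by
  rw [tensorFlip_modeVector, (hm.add_odd odd_one).neg_one_pow, one_smul]

theorem tensorFlip_modeVector_of_even (k : ℕ) {m : ℕ} (hm : Even m) :
    tensorFlip H (modeVector e k m) = -modeVector e k m := by
  rw [tensorFlip_modeVector, hm.add_one.neg_one_pow, neg_one_smul]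

variable [CompleteSpace H] {a : ℝ} (ha : 1 ≤ a)

theorem geometricShift_apply_basis (i : ℕ) :
    geometricShift e a ha (e i) = ((1 / a ^ i : ℝ) : ℂ) • e (i + 1) :=
  weightedShift_apply_basis e _ _ i

theorem inner_basis_adjoint_geometricShift (i j : ℕ) :
    inner ℂ (e j) ((geometricShift e a ha).adjoint (e i)) =
      if j + 1 = i then ((1 / a ^ j : ℝ) : ℂ) else 0 := by
  rw [ContinuousLinearMap.adjoint_inner_right, geometricShift_apply_basis, inner_smul_left,
    orthonormal_iff_ite.1 e.orthonormal, Complex.conj_ofReal]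
  split_ifs <;> simp

theorem adjoint_geometricShift_apply_zero : (geometricShift e a ha).adjoint (e 0) = 0 := by
  refine e.ext_repr fun j => ?_
  rw [e.repr_apply_apply, inner_basis_adjoint_geometricShift]
  simp

theorem adjoint_geometricShift_apply_succ (i : ℕ) :
    (geometricShift e a ha).adjoint (e (i + 1)) = ((1 / a ^ i : ℝ) : ℂ) • e i := by
  refine e.ext_repr fun j => ?_
  rw [e.repr_apply_apply, e.repr_apply_apply, inner_basis_adjoint_geometricShift, inner_smul_right,
    orthonormal_iff_ite.1 e.orthonormal]
  by_cases h : j = i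
  · simp [h]
  · simp [h]

/-- The product of the two weights that move `e i ⊗ e (j + 1)` to `e (i + 1) ⊗ e j` depends only on
the degree `i + j + 1`. -/
theorem one_div_pow_mul_one_div_pow (a : ℝ) (i j : ℕ) :
    ((1 / a ^ i : ℝ) : ℂ) * ((1 / a ^ j : ℝ) : ℂ) =
      ((1 / a ^ (((i + j + 1 : ℕ) : ℤ) - 1) : ℝ) : ℂ) := by
  have : ((i + j + 1 : ℕ) : ℤ) - 1 = (i + j : ℕ) := by push_cast; ring
  rw [this, zpow_natCast, pow_add, ← Complex.ofReal_mul, one_div_mul_one_div]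

theorem tensorOp_shift_adjoint_basisTensor {i k : ℕ} (h : i < k) :
    tensorOp (geometricShift e a ha) (geometricShift e a ha).adjoint (basisTensor e i (k - i)) =
      ((1 / a ^ ((k : ℤ) - 1) : ℝ) : ℂ) • basisTensor e (i + 1) (k - (i + 1)) := by
  obtain ⟨j, rfl⟩ : ∃ j, k = i + j + 1 := ⟨k - i - 1, by omega⟩
  rw [show i + j + 1 - i = j + 1 by omega, show i + j + 1 - (i + 1) = j by omega,
    tensorOp_basisTensor, geometricShift_apply_basis, adjoint_geometricShift_apply_succ,
    TensorProduct.smul_tmul_smul, map_smul, one_div_pow_mul_one_div_pow a, basisTensor]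

theorem tensorOp_adjoint_shift_basisTensor {i k : ℕ} (h : i < k) :
    tensorOp (geometricShift e a ha).adjoint (geometricShift e a ha)
        (basisTensor e (i + 1) (k - (i + 1))) =
      ((1 / a ^ ((k : ℤ) - 1) : ℝ) : ℂ) • basisTensor e i (k - i) := by
  obtain ⟨j, rfl⟩ : ∃ j, k = i + j + 1 := ⟨k - i - 1, by omega⟩
  rw [show i + j + 1 - i = j + 1 by omega, show i + j + 1 - (i + 1) = j by omega,
    tensorOp_basisTensor, geometricShift_apply_basis, adjoint_geometricShift_apply_succ,
    TensorProduct.smul_tmul_smul, map_smul, one_div_pow_mul_one_div_pow a, basisTensor]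

/-- On the path of tensors of degree `k` the operator is a multiple of the adjacency matrix, and
`sin ((i + 2) * θ) + sin (i * θ) = 2 * cos θ * sin ((i + 1) * θ)`; the boundary terms vanish
because `sin 0 = sin (m * π) = 0`. -/
theorem symmetrizedOp_modeVector (k m : ℕ) :
    symmetrizedOp (geometricShift e a ha) (geometricShift e a ha).adjoint (modeVector e k m) =
      (modeValue a k m : ℂ) • modeVector e k m := by
  set θ : ℝ := m * Real.pi / (k + 2) with hθ
  set S := geometricShift e a ha
  set w : ℂ := ((1 / a ^ ((k : ℤ) - 1) : ℝ) : ℂ) with hw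
  set E : ℕ → HilbertTensorSq H := fun i => basisTensor e i (k - i) with hE
  have hv : modeVector e k m =
      ∑ i ∈ Finset.range (k + 1), (Real.sin ((i + 1 : ℕ) * θ) : ℂ) • E i := rfl
  have hup : tensorOp S S.adjoint (modeVector e k m) =
      w • ∑ i ∈ Finset.range (k + 1), (Real.sin (i * θ) : ℂ) • E i := by
    have hlast : tensorOp S S.adjoint (E k) = 0 := by
      rw [hE]
      simp only [Nat.sub_self]
      rw [tensorOp_basisTensor, adjoint_geometricShift_apply_zero, TensorProduct.tmul_zero,
        map_zero]
    rw [hv, map_sum, Finset.sum_range_succ, map_smul, hlast, smul_zero, add_zero,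
      Finset.sum_range_succ', Nat.cast_zero, zero_mul, Real.sin_zero, Complex.ofReal_zero,
      zero_smul, add_zero, Finset.smul_sum]
    refine Finset.sum_congr rfl fun i hi => ?_
    rw [map_smul, tensorOp_shift_adjoint_basisTensor e ha (Finset.mem_range.1 hi), smul_comm]
  have hdown : tensorOp S.adjoint S (modeVector e k m) =
      w • ∑ i ∈ Finset.range (k + 1), (Real.sin ((i + 2 : ℕ) * θ) : ℂ) • E i := by
    have hfirst : tensorOp S.adjoint S (E 0) = 0 := by
      rw [hE]
      rw [tensorOp_basisTensor, adjoint_geometricShift_apply_zero, TensorProduct.zero_tmul,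
        map_zero]
    have hsin : Real.sin ((k + 2 : ℕ) * θ) = 0 := by
      rw [hθ, show ((k + 2 : ℕ) : ℝ) * (m * Real.pi / (k + 2)) = m * Real.pi by
        push_cast; field_simp]
      exact Real.sin_nat_mul_pi m
    rw [hv, map_sum, Finset.sum_range_succ', map_smul, hfirst, smul_zero, add_zero,
      Finset.sum_range_succ _ k, hsin, Complex.ofReal_zero, zero_smul, add_zero, Finset.smul_sum]
    refine Finset.sum_congr rfl fun i hi => ?_
    rw [map_smul, tensorOp_adjoint_shift_basisTensor e ha (Finset.mem_range.1 hi), smul_comm]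
  rw [symmetrizedOp, smul_apply, add_apply, hup, hdown, ← smul_add, ← Finset.sum_add_distrib, hv,
    Finset.smul_sum, Finset.smul_sum, Finset.smul_sum]
  refine Finset.sum_congr rfl fun i _ => ?_
  have htrig : Real.sin (i * θ) + Real.sin ((i + 2 : ℕ) * θ) =
      2 * Real.cos θ * Real.sin ((i + 1 : ℕ) * θ) := by
    rw [show (i : ℝ) * θ = (i + 1 : ℕ) * θ - θ by push_cast; ring,
      show ((i + 2 : ℕ) : ℝ) * θ = (i + 1 : ℕ) * θ + θ by push_cast; ring,
      Real.sin_sub, Real.sin_add]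
    ring
  rw [← add_smul, smul_smul, smul_smul, smul_smul, ← Complex.ofReal_add, htrig, modeValue, ← hθ]
  congr 1
  rw [hw]
  push_cast
  ring

theorem modeValue_injOn (ha : 1 ≤ a) (k : ℕ) {m m' : ℕ} (h1 : m ≤ k + 1) (h2 : m' ≤ k + 1)
    (h : modeValue a k m = modeValue a k m') : m = m' := by
  have hpos : (0 : ℝ) < 1 / a ^ ((k : ℤ) - 1) := by positivity
  have hmem : ∀ n : ℕ, n ≤ k + 1 → (n : ℝ) * Real.pi / (k + 2) ∈ Set.Icc 0 Real.pi := by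
    intro n hn
    have hn' : (n : ℝ) ≤ k + 2 := by exact_mod_cast (by omega : n ≤ k + 2)
    refine ⟨by positivity, ?_⟩
    rw [div_le_iff₀ (by positivity), mul_comm]
    exact mul_le_mul_of_nonneg_left hn' Real.pi_pos.le
  have hcos := Real.injOn_cos (hmem m h1) (hmem m' h2) (mul_left_cancel₀ hpos.ne' h)
  have hk : (k : ℝ) + 2 ≠ 0 := by positivity
  exact_mod_cast mul_right_cancel₀ Real.pi_ne_zero ((div_left_inj' hk).1 hcos)

include ha in
/-- For equal degrees these are eigenvectors of a symmetric operator for distinct eigenvalues. -/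
theorem inner_modeVector_eq_zero {k m k' m' : ℕ} (h1 : m ≤ k + 1) (h2 : m' ≤ k' + 1)
    (hne : (k, m) ≠ (k', m')) : inner ℂ (modeVector e k m) (modeVector e k' m') = 0 := by
  by_cases hk : k = k'
  · subst hk
    have hsym := isSymmetric_symmetrizedOp_adjoint (geometricShift e a ha) (modeVector e k m)
      (modeVector e k m')
    simp only [ContinuousLinearMap.coe_coe] at hsym
    rw [symmetrizedOp_modeVector, symmetrizedOp_modeVector, inner_smul_left, inner_smul_right,
      Complex.conj_ofReal, ← sub_eq_zero, ← sub_mul] at hsym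
    refine (mul_eq_zero.1 hsym).resolve_left fun h => hne ?_
    rw [modeValue_injOn ha k h1 h2 (by exact_mod_cast sub_eq_zero.1 h)]
  · exact inner_modeVector_of_ne e hk m m'

include ha in
/-- The `k + 1` independent vectors `modeVector e k m` span the `k + 1`-dimensional space of
tensors of degree `k`. -/
theorem eq_zero_of_inner_modeVector_eq_zero {x : HilbertTensorSq H}
    (h : ∀ k m, 1 ≤ m → m ≤ k + 1 → inner ℂ (modeVector e k m) x = 0) : x = 0 := by
  have key : ∀ k i, i ≤ k → inner ℂ (basisTensor e i (k - i)) x = 0 := by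
    intro k i hi
    let E : Fin (k + 1) → HilbertTensorSq H := fun i => basisTensor e i (k - i)
    -- The index is shifted by one, so that `m + 1` runs through `1, …, k + 1`.
    let v : Fin (k + 1) → HilbertTensorSq H := fun m => modeVector e k (m + 1)
    have hli : LinearIndependent ℂ v := by
      refine linearIndependent_of_ne_zero_of_inner_eq_zero
        (fun m => modeVector_ne_zero e (by omega) (by omega)) fun m m' hmm => ?_
      refine inner_modeVector_eq_zero e ha (by omega) (by omega) fun heq => hmm (Fin.ext ?_)
      simpa using heq
    have hle : Submodule.span ℂ (Set.range v) ≤ Submodule.span ℂ (Set.range E) := by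
      refine Submodule.span_le.2 ?_
      rintro _ ⟨m, rfl⟩
      exact Submodule.sum_mem _ fun i hi => Submodule.smul_mem _ _
        (Submodule.subset_span ⟨⟨i, Finset.mem_range.1 hi⟩, rfl⟩)
    have : FiniteDimensional ℂ (Submodule.span ℂ (Set.range E)) :=
      FiniteDimensional.span_of_finite ℂ (Set.finite_range E)
    have hspan := Submodule.eq_of_le_of_finrank_le hle (by
      rw [finrank_span_eq_card hli]
      exact finrank_range_le_card E)
    have hmem : basisTensor e i (k - i) ∈ Submodule.span ℂ (Set.range v) := by
      rw [hspan]
      exact Submodule.subset_span ⟨⟨i, Nat.lt_succ_of_le hi⟩, rfl⟩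
    refine Submodule.span_induction (p := fun y _ => inner ℂ y x = 0) ?_ (inner_zero_left _)
      (fun y z _ _ hy hz => by rw [inner_add_left, hy, hz, add_zero])
      (fun c y _ hy => by rw [inner_smul_left, hy, mul_zero]) hmem
    rintro _ ⟨m, rfl⟩
    exact h k _ (by omega) (by omega)
  refine eq_zero_of_inner_basisTensor_eq_zero e fun i j => ?_
  simpa using key (i + j) i (by omega)

/-- A restriction of the symmetrized operator to a subspace that contains some of the vectors
`modeVector e k m` and is orthogonal to the others is diagonal in a Hilbert basis. -/
theorem exists_hilbertBasis_modeVector {ι : Type*} (W : Submodule ℂ (HilbertTensorSq H))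
    [CompleteSpace W] (T : W →L[ℂ] W)
    (hT : ∀ x, (T x : HilbertTensorSq H) =
      symmetrizedOp (geometricShift e a ha) (geometricShift e a ha).adjoint x)
    (κ : ι → ℕ × ℕ) (hκ : Function.Injective κ)
    (hrange : ∀ i, 1 ≤ (κ i).2 ∧ (κ i).2 ≤ (κ i).1 + 1)
    (hmem : ∀ i, modeVector e (κ i).1 (κ i).2 ∈ W)
    (horth : ∀ x ∈ W, ∀ k m, 1 ≤ m → m ≤ k + 1 → (k, m) ∉ Set.range κ →
      inner ℂ (modeVector e k m) x = 0) :
    (T : W →ₗ[ℂ] W).IsSymmetric ∧ ∃ b : HilbertBasis ι ℂ W,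
      ∀ i, T (b i) = (modeValue a (κ i).1 (κ i).2 : ℂ) • b i := by
  constructor
  · intro x y
    have := isSymmetric_symmetrizedOp_adjoint (geometricShift e a ha) x y
    simpa only [Submodule.coe_inner, ContinuousLinearMap.coe_coe, hT] using this
  · obtain ⟨b, hb⟩ := exists_hilbertBasis_of_orthogonal
      (fun i => (⟨modeVector e (κ i).1 (κ i).2, hmem i⟩ : W))
      (fun i h => modeVector_ne_zero e (hrange i).1 (hrange i).2 (congrArg Subtype.val h))
      (fun i j hij => inner_modeVector_eq_zero e ha (hrange i).2 (hrange j).2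
        fun h => hij (hκ h))
      (fun x hx => by
        refine Subtype.ext (eq_zero_of_inner_modeVector_eq_zero e ha fun k m h1 h2 => ?_)
        by_cases hkm : (k, m) ∈ Set.range κ
        · obtain ⟨i, hi⟩ := hkm
          have := hx i
          rw [Submodule.coe_inner] at this
          simpa only [hi] using this
        · exact horth x x.2 k m h1 h2 hkm)
    refine ⟨b, fun i => ?_⟩
    rw [hb, map_smul, smul_comm]
    congr 1
    refine Subtype.ext ?_
    rw [hT, Submodule.coe_smul]
    exact symmetrizedOp_modeVector e ha _ _

end Modes

/-! ### Spectra of the restrictions to symmetric and antisymmetric tensors -/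

section Spectra

/-- For `a > 1` only finitely many degrees `k` carry values of modulus at least a given `ε > 0`. -/
theorem tendsto_modeValue_cofinite {a : ℝ} (ha : 1 < a) {ι : Type*} {κ : ι → ℕ × ℕ}
    (hκ : Function.Injective κ) (hrange : ∀ i, (κ i).2 ≤ (κ i).1 + 1) :
    Filter.Tendsto (fun i => modeValue a (κ i).1 (κ i).2) Filter.cofinite (nhds 0) := by
  have ha0 : 0 < a := one_pos.trans ha
  rw [Metric.tendsto_nhds]
  intro ε hε
  have hpow : Filter.Tendsto (fun k : ℕ => a * a⁻¹ ^ k) Filter.atTop (nhds 0) := by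
    simpa using (tendsto_pow_atTop_nhds_zero_of_lt_one (inv_nonneg.2 ha0.le)
      (inv_lt_one_of_one_lt₀ ha)).const_mul a
  obtain ⟨N, hN⟩ := Filter.eventually_atTop.1 (hpow.eventually_lt_const hε)
  rw [Filter.eventually_cofinite]
  refine Set.Finite.subset (((Set.finite_Iio N).prod (Set.finite_Iio (N + 1))).preimage
    hκ.injOn) fun i hi => ?_
  by_contra hnot
  refine hi ?_
  have hk : N ≤ (κ i).1 := by
    by_contra hlt
    refine hnot ⟨not_le.1 hlt, ?_⟩
    have := hrange i
    simp only [Set.mem_Iio]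
    omega
  rw [dist_zero_right, Real.norm_eq_abs, modeValue, abs_mul]
  have hscale : (1 : ℝ) / a ^ (((κ i).1 : ℤ) - 1) = a * a⁻¹ ^ (κ i).1 := by
    rw [zpow_sub_one₀ ha0.ne', zpow_natCast, inv_pow]
    field_simp
  rw [hscale, abs_of_nonneg (by positivity)]
  exact (mul_le_of_le_one_right (by positivity) (Real.abs_cos_le_one _)).trans_lt (hN _ hk)

variable {H : Type*} [NormedAddCommGroup H] [InnerProductSpace ℂ H] [CompleteSpace H]
  (e : HilbertBasis ℕ ℂ H) {a : ℝ} (ha : 1 ≤ a)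

/-- The spectral data of a restriction whose listed eigenvalues `value q`, `q ∈ I`, are those of the
vectors `modeVector e k m` with `(k, m) = κ q`. -/
theorem spectral_description_of_restriction (I : Set (ℕ × ℕ)) (value : ℕ × ℕ → ℂ)
    (W : Submodule ℂ (HilbertTensorSq H)) [CompleteSpace W] (T : W →L[ℂ] W)
    (hT : ∀ x, (T x : HilbertTensorSq H) =
      symmetrizedOp (geometricShift e a ha) (geometricShift e a ha).adjoint x)
    (κ : ℕ × ℕ → ℕ × ℕ) (hκ : Set.InjOn κ I)
    (hvalue : ∀ q ∈ I, value q = modeValue a (κ q).1 (κ q).2)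
    (hrange : ∀ q ∈ I, 1 ≤ (κ q).2 ∧ (κ q).2 ≤ (κ q).1 + 1)
    (hmem : ∀ q ∈ I, modeVector e (κ q).1 (κ q).2 ∈ W)
    (horth : ∀ x ∈ W, ∀ k m, 1 ≤ m → m ≤ k + 1 → (k, m) ∉ κ '' I →
      inner ℂ (modeVector e k m) x = 0)
    (hzero : {q | q ∈ I ∧ value q = 0}.Infinite) :
    (pointSpectrum T = value '' I ∧
      ∀ μ : ℂ, eigenvalueMultiplicity T μ = {q | q ∈ I ∧ value q = μ}.encard) ∧
    ¬ FiniteDimensional ℂ T.ker ∧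
    (1 < a → IsCompactOperator T ∧ IsSelfAdjoint T ∧ spectrum ℂ T = pointSpectrum T) := by
  obtain ⟨hsym, b, hb⟩ := exists_hilbertBasis_modeVector e ha W T hT (fun q : I => κ q)
    hκ.injective (fun q => hrange q q.2) (fun q => hmem q q.2)
    (by simpa only [Set.image_eq_range] using horth)
  have himage : ∀ μ : ℂ, {q | q ∈ I ∧ value q = μ} =
      Subtype.val '' {q : I | (modeValue a (κ q).1 (κ q).2 : ℂ) = μ} := by
    intro μ
    ext q
    constructor
    · rintro ⟨hq, h⟩
      exact ⟨⟨q, hq⟩, (hvalue q hq).symm.trans h, rfl⟩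
    · rintro ⟨q, h, rfl⟩
      exact ⟨q.2, (hvalue q q.2).trans h⟩
  have hpoint : pointSpectrum T = value '' I := by
    rw [pointSpectrum_of_diagonal hsym b hb, Set.image_eq_range]
    exact congrArg Set.range (funext fun q => (hvalue q q.2).symm)
  refine ⟨⟨hpoint, fun μ => ?_⟩, ?_, fun ha1 => ?_⟩
  · rw [eigenvalueMultiplicity_of_diagonal hsym b hb, himage,
      Subtype.val_injective.encard_image]
  · refine not_finiteDimensional_ker_of_diagonal hsym b hb ?_
    rw [himage] at hzero
    simpa using hzero.of_image _
  · have hcompact := isCompactOperator_of_diagonal hsym b hb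
      (tendsto_modeValue_cofinite ha1 hκ.injective fun q => (hrange q q.2).2)
    refine ⟨hcompact, ContinuousLinearMap.isSelfAdjoint_iff_isSymmetric.2 hsym,
      spectrum_eq_pointSpectrum_of_isCompactOperator hcompact ?_⟩
    obtain ⟨q, hq⟩ := hzero.nonempty
    rw [hpoint]
    exact ⟨q, hq⟩

/-- The eigenvalue vanishes at `(k, j) = (4 * j - 4, j)`, where the angle is `π / 2`. -/
theorem infinite_symValue_eq_zero (a : ℝ) : {q | q ∈ symIndex ∧ symValue a q = 0}.Infinite := by
  refine Set.infinite_of_injective_forall_mem (f := fun n : ℕ => (4 * n, n + 1))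
    (fun m n h => by simpa using congrArg Prod.snd h) fun n => ⟨⟨by simp, by simp; omega⟩, ?_⟩
  have : (2 * ((n + 1 : ℕ) : ℝ) - 1) * Real.pi / ((4 * n : ℕ) + 2) = Real.pi / 2 := by
    push_cast
    field_simp
    ring
  simp only [symValue]
  rw [this, Real.cos_pi_div_two, mul_zero, Complex.ofReal_zero]

/-- The eigenvalue vanishes at `(k, j) = (4 * j - 2, j)`, where the angle is `π / 2`. -/
theorem infinite_antisymValue_eq_zero (a : ℝ) :
    {q | q ∈ antisymIndex ∧ antisymValue a q = 0}.Infinite := by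
  refine Set.infinite_of_injective_forall_mem (f := fun n : ℕ => (4 * n + 2, n + 1))
    (fun m n h => by simpa using congrArg Prod.snd h)
    fun n => ⟨⟨by simp, by simp, by simp; omega⟩, ?_⟩
  have : 2 * ((n + 1 : ℕ) : ℝ) * Real.pi / ((4 * n + 2 : ℕ) + 2) = Real.pi / 2 := by
    push_cast
    field_simp
    ring
  simp only [antisymValue]
  rw [this, Real.cos_pi_div_two, mul_zero, Complex.ofReal_zero]

theorem spectral_description_symShift :
    (pointSpectrum (symShift e a ha) = symValue a '' symIndex ∧
      ∀ μ : ℂ, eigenvalueMultiplicity (symShift e a ha) μ =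
        {q | q ∈ symIndex ∧ symValue a q = μ}.encard) ∧
    ¬ FiniteDimensional ℂ (symShift e a ha).ker ∧
    (1 < a → IsCompactOperator (symShift e a ha) ∧ IsSelfAdjoint (symShift e a ha) ∧
      spectrum ℂ (symShift e a ha) = pointSpectrum (symShift e a ha)) := by
  refine spectral_description_of_restriction e ha symIndex (symValue a) (symTensor H)
    (symShift e a ha) (fun _ => rfl) (fun q => (q.1, 2 * q.2 - 1)) ?_ ?_ ?_ ?_ ?_
    (infinite_symValue_eq_zero a)
  · rintro ⟨k, j⟩ ⟨hj, -⟩ ⟨k', j'⟩ ⟨hj', -⟩ h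
    simp only [Prod.mk.injEq] at h hj hj' ⊢
    omega
  · rintro ⟨k, j⟩ ⟨hj, -⟩
    simp only at hj
    simp only [symValue, modeValue]
    rw [Nat.cast_sub (by omega)]
    push_cast
    rfl
  · rintro ⟨k, j⟩ ⟨hj, hjk⟩
    simp only at hj hjk ⊢
    omega
  · rintro ⟨k, j⟩ ⟨hj, -⟩
    exact tensorFlip_modeVector_of_odd e k
      (Nat.Even.sub_odd (by simp only at hj; omega) (even_two_mul j) odd_one)
  · intro x hx k m h1 h2 hkm
    rcases Nat.even_or_odd m with hm | hm
    · exact inner_eq_zero_symm.1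
        (inner_eq_zero_of_tensorFlip hx (tensorFlip_modeVector_of_even e k hm))
    · obtain ⟨n, rfl⟩ := hm
      exact absurd ⟨(k, n + 1), ⟨by simp, by simp only; omega⟩, by simp; omega⟩ hkm

theorem spectral_description_antisymShift :
    (pointSpectrum (antisymShift e a ha) = antisymValue a '' antisymIndex ∧
      ∀ μ : ℂ, eigenvalueMultiplicity (antisymShift e a ha) μ =
        {q | q ∈ antisymIndex ∧ antisymValue a q = μ}.encard) ∧
    ¬ FiniteDimensional ℂ (antisymShift e a ha).ker ∧
    (1 < a → IsCompactOperator (antisymShift e a ha) ∧ IsSelfAdjoint (antisymShift e a ha) ∧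
      spectrum ℂ (antisymShift e a ha) = pointSpectrum (antisymShift e a ha)) := by
  refine spectral_description_of_restriction e ha antisymIndex (antisymValue a) (antisymTensor H)
    (antisymShift e a ha) (fun _ => rfl) (fun q => (q.1, 2 * q.2)) ?_ ?_ ?_ ?_ ?_
    (infinite_antisymValue_eq_zero a)
  · rintro ⟨k, j⟩ - ⟨k', j'⟩ - h
    simp only [Prod.mk.injEq] at h ⊢
    omega
  · rintro ⟨k, j⟩ -
    simp only [antisymValue, modeValue]
    push_cast
    rfl
  · rintro ⟨k, j⟩ ⟨hk, hj, hjk⟩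
    simp only at hk hj hjk ⊢
    omega
  · rintro ⟨k, j⟩ -
    exact tensorFlip_modeVector_of_even e k (even_two_mul j)
  · intro x hx k m h1 h2 hkm
    rcases Nat.even_or_odd' m with ⟨n, rfl | rfl⟩
    · exact absurd
        ⟨(k, n), ⟨by simp only; omega, by simp only; omega, by simp only; omega⟩, rfl⟩ hkm
    · exact inner_eq_zero_of_tensorFlip
        (tensorFlip_modeVector_of_odd e k (odd_two_mul_add_one n)) hx

end Spectra

end

theorem corollary3p4 {H : Type*} [NormedAddCommGroup H] [InnerProductSpace ℂ H] [CompleteSpace H]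
    (e : HilbertBasis ℕ ℂ H) (a : ℝ) (ha : 1 ≤ a) :
    -- the point spectra as sets, and the multiplicity of every complex number in the two families
    (pointSpectrum (symShift e a ha) = symValue a '' symIndex ∧
      ∀ μ : ℂ, eigenvalueMultiplicity (symShift e a ha) μ =
        {q | q ∈ symIndex ∧ symValue a q = μ}.encard) ∧
    (pointSpectrum (antisymShift e a ha) = antisymValue a '' antisymIndex ∧
      ∀ μ : ℂ, eigenvalueMultiplicity (antisymShift e a ha) μ =
        {q | q ∈ antisymIndex ∧ antisymValue a q = μ}.encard) ∧
    ¬ FiniteDimensional ℂ (symShift e a ha).ker ∧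
    ¬ FiniteDimensional ℂ (antisymShift e a ha).ker ∧
    (1 < a →
      (IsCompactOperator (symShift e a ha) ∧ IsSelfAdjoint (symShift e a ha) ∧
        spectrum ℂ (symShift e a ha) = pointSpectrum (symShift e a ha)) ∧
      (IsCompactOperator (antisymShift e a ha) ∧ IsSelfAdjoint (antisymShift e a ha) ∧
        spectrum ℂ (antisymShift e a ha) = pointSpectrum (antisymShift e a ha))) := by
  obtain ⟨hs, hsker, hscompact⟩ := spectral_description_symShift e ha
  obtain ⟨ht, htker, htcompact⟩ := spectral_description_antisymShift e ha
  exact ⟨hs, ht, hsker, htker, fun ha1 => ⟨hscompact ha1, htcompact ha1⟩⟩
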